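/- Let $X=[\underline x,\overline x]$ and $Y=[\underline y,\overline y]$ be real intervals with $\underline x<\overline x$ and $\underline y<\overline y$, let $F$ and $G$ be arbitrary Borel probability distributions on $X$ (firms) and on $Y$ (workers), identified with their cdfs, and let $v:X\times Y\to\mathbb R$ be Lipschitz. (Mean-measurable case: firm $x$ with workforce $\eta\in\Delta(Y)$ produces $V(x,\eta)=v(x,\mathbb E_\eta[y])$.) For a distribution $H$ on $Y$, write $H\succeq G$ ($H$ majorizes $G$) if $\int_{\underline y}^{y}H(t)\,dt\le\int_{\underline y}^{y}G(t)\,dt$ for all $y\in Y$, with equality at $y=\overline y$. An assignment is a Borel probability distribution $J$ on $X\times Y$ with marginals $J_X=F$ and $J_Y$ such that $J_Y$ can be obtained by splitting $G$: there is a probability distribution $\tau$ on $\Delta(Y)$ with $\mathbb E_\tau[\eta]=G$ under which $\mathbb E_\eta[y]$ has distribution $J_Y$. A competitive equilibrium $(J;p,q)$ is an assignment $J$ together with Lipschitz functions $p:X\to\mathbb R$ and $q:Y\to\mathbb R$ such that $p(x)+q(z)=v(x,z)$ for all $(x,z)\in\operatorname{supp}(J)$, $p(x)+q(z)\ge v(x,z)$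 for all $(x,z)\in X\times Y$, $q$ is convex, and $\mathbb E_{J_Y}[q]=\mathbb E_G[q]$. Consider the planner's problem $$(P_L)\qquad \max_{J\in\Delta(X\times Y)}\mathbb E_J[v(x,z)]\quad\text{s.t. } J_X=F,\ J_Y\succeq G,$$ and the dual problem $$(D_L)\qquad \min_{p,q\text{ Lipschitz}}\mathbb E_F[p]+\mathbb E_G[q]\quad\text{s.t. } p(x)+q(z)\ge v(x,z)\ \text{for all }(x,z)\in X\times Y,\ q\text{ convex}.$$ Then a competitive equilibrium exists. Moreover, for every Borel probability distribution $J$ on $X\times Y$ and all functions $p:X\to\mathbb R$, $q:Y\to\mathbb R$, $(J;p,q)$ is a competitive equilibrium if and only if $J$ solves $(P_L)$ and $(p,q)$ solves $(D_L)$. Here, a probability distribution $J$ on $X\times Y$ is an assignment if and only if $J_X=F$ and $J_Y\succeq G$. -/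

import Mathlib

open MeasureTheory ProbabilityTheory Set

noncomputable section

namespace ManyToOne

/-- `f` is Lipschitz continuous, with some finite constant. -/
def IsLip {α : Type*} [PseudoEMetricSpace α] (f : α → ℝ) : Prop :=
  ∃ K : NNReal, LipschitzWith K f

/-- `q` is a convex function on the interval `[c, d]`. -/
def IsConv {c d : ℝ} (q : Icc c d → ℝ) : Prop :=
  ∀ y z w : Icc c d, ∀ s t : ℝ, 0 ≤ s → 0 ≤ t → s + t = 1 →
    (w : ℝ) = s * (y : ℝ) + t * (z : ℝ) → q w ≤ s * q y + t * q z

theorem mean_mem {c d : ℝ} (η : ProbabilityMeasure (Icc c d)) :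
    ∫ y, (y : ℝ) ∂(η : Measure (Icc c d)) ∈ Icc c d := by
  have hi : Integrable (fun y : Icc c d => (y : ℝ)) (η : Measure (Icc c d)) :=
    Integrable.of_bound (C := max |c| |d|) measurable_subtype_coe.aestronglyMeasurable
      (Filter.Eventually.of_forall fun y => abs_le_max_abs_abs y.2.1 y.2.2)
  constructor
  · have h := integral_mono (integrable_const c) hi (fun y => y.2.1)
    simpa using h
  · have h := integral_mono hi (integrable_const d) (fun y => y.2.2)
    simpa using h

/-- The mean skill `E_η[y]` of a workforce `η`, a probability measure on `[c, d]`. -/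
def workforceMean {c d : ℝ} (η : ProbabilityMeasure (Icc c d)) : Icc c d :=
  ⟨∫ y, (y : ℝ) ∂(η : Measure (Icc c d)), mean_mem η⟩

/-- `H` can be obtained by splitting the population distribution `G` into a distribution `τ` of
workforces `η` (the average workforce is `G`) whose means `E_η[y]` have distribution `H`. -/
def ObtainedBySplitting {c d : ℝ} (H : Measure (Icc c d)) (G : ProbabilityMeasure (Icc c d)) :
    Prop :=
  ∃ τ : Measure (ProbabilityMeasure (Icc c d)), IsProbabilityMeasure τ ∧
    (∀ s : Set (Icc c d), MeasurableSet s →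
      ∫⁻ η, (η : Measure (Icc c d)) s ∂τ = (G : Measure (Icc c d)) s) ∧
    τ.map workforceMean = H

/-- The cumulative distribution function of a distribution on `[c, d]`. -/
def cdfOn {c d : ℝ} (H : Measure (Icc c d)) (t : ℝ) : ℝ :=
  cdf (H.map ((↑) : Icc c d → ℝ)) t

/-- `H` majorizes `G`: the integrated cdf of `H` lies below that of `G` on `[c, d]`, with equality
at the upper end point. -/
def Majorizes {c d : ℝ} (H G : Measure (Icc c d)) : Prop :=
  (∀ y ∈ Icc c d, ∫ t in c..y, cdfOn H t ≤ ∫ t in c..y, cdfOn G t) ∧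
    ∫ t in c..d, cdfOn H t = ∫ t in c..d, cdfOn G t

variable {a b c d : ℝ}

/-- An assignment: a distribution of (firm, workforce mean) pairs whose first marginal is `F` and
whose second marginal is obtained by splitting `G`. -/
structure IsAssignment (F : ProbabilityMeasure (Icc a b)) (G : ProbabilityMeasure (Icc c d))
    (J : ProbabilityMeasure (Icc a b × Icc c d)) : Prop where
  fst_eq : (J : Measure (Icc a b × Icc c d)).fst = (F : Measure (Icc a b))
  snd_split : ObtainedBySplitting (J : Measure (Icc a b × Icc c d)).snd G

/-- Competitive equilibrium `(J; p, q)` for the production function `v`. -/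
structure IsCompetitiveEquilibrium (v : Icc a b × Icc c d → ℝ)
    (F : ProbabilityMeasure (Icc a b)) (G : ProbabilityMeasure (Icc c d))
    (J : ProbabilityMeasure (Icc a b × Icc c d)) (p : Icc a b → ℝ) (q : Icc c d → ℝ) : Prop where
  assignment : IsAssignment F G J
  lip_p : IsLip p
  lip_q : IsLip q
  eq_on_support : ∀ x z, (x, z) ∈ (J : Measure (Icc a b × Icc c d)).support →
    p x + q z = v (x, z)
  no_entry : ∀ x z, v (x, z) ≤ p x + q z
  conv : IsConv q
  wages : ∫ z, q z ∂(J : Measure (Icc a b × Icc c d)).snd = ∫ y, q y ∂(G : Measure (Icc c d))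

/-- Feasibility in the planner's problem. -/
def PlannerFeasible (F : ProbabilityMeasure (Icc a b)) (G : ProbabilityMeasure (Icc c d))
    (J : ProbabilityMeasure (Icc a b × Icc c d)) : Prop :=
  (J : Measure (Icc a b × Icc c d)).fst = (F : Measure (Icc a b)) ∧
    Majorizes (J : Measure (Icc a b × Icc c d)).snd (G : Measure (Icc c d))

/-- `J` solves the planner's problem: it maximizes `E_J[v]` over the feasible `J`. -/
def SolvesPlanner (v : Icc a b × Icc c d → ℝ)
    (F : ProbabilityMeasure (Icc a b)) (G : ProbabilityMeasure (Icc c d))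
    (J : ProbabilityMeasure (Icc a b × Icc c d)) : Prop :=
  PlannerFeasible F G J ∧ ∀ J' : ProbabilityMeasure (Icc a b × Icc c d), PlannerFeasible F G J' →
    ∫ w, v w ∂(J' : Measure (Icc a b × Icc c d)) ≤ ∫ w, v w ∂(J : Measure (Icc a b × Icc c d))

/-- Feasibility in the dual problem. -/
def DualFeasible (v : Icc a b × Icc c d → ℝ) (p : Icc a b → ℝ) (q : Icc c d → ℝ) : Prop :=
  IsLip p ∧ IsLip q ∧ (∀ x z, v (x, z) ≤ p x + q z) ∧ IsConv q

/-- `(p, q)` solves the dual problem: it minimizes `E_F[p] + E_G[q]` over the feasible pairs. -/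
def SolvesDual (v : Icc a b × Icc c d → ℝ)
    (F : ProbabilityMeasure (Icc a b)) (G : ProbabilityMeasure (Icc c d))
    (p : Icc a b → ℝ) (q : Icc c d → ℝ) : Prop :=
  DualFeasible v p q ∧ ∀ p' q', DualFeasible v p' q' →
    ∫ x, p x ∂(F : Measure (Icc a b)) + ∫ y, q y ∂(G : Measure (Icc c d)) ≤
      ∫ x, p' x ∂(F : Measure (Icc a b)) + ∫ y, q' y ∂(G : Measure (Icc c d))

end ManyToOne

end

/-! ### Probability measures from positive functionals and cones -/

namespace ManyToOne

/-! The theorem is linear programming duality. For feasible J and (p, q), weak duality is the chain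
E_J[v] ≤ E_J[p + q] = E_F[p] + E_{J_Y}[q] ≤ E_F[p] + E_G[q], the last step because q is convex and
J_Y majorizes G. Both inequalities are equalities exactly when p + q = v on the support of J and the
wage bill condition holds. So equilibria are the feasible pairs with equal values
(`isCompetitiveEquilibrium_iff`), and everything reduces to attainment of both optima without a gap.

The dual minimum is attained by Arzelà–Ascoli (`exists_dual_solution`), since any dual pair can be
improved to one with a fixed Lipschitz constant and fixed bounds. A planner's solution of the same
value comes from Hahn–Banach and Riesz (`exists_probabilityMeasure_of_cone`,
`exists_planner_value`).

Splitting is identified with majorization by Strassen's theorem: Jensen in one direction; in the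
other a martingale coupling, from the same cone argument, whose conditional laws are the workforces.
-/

open scoped CompactlySupported in
/-- A positive normalized linear functional on `C(K, ℝ)` is integration against a probability
measure. -/
theorem exists_probabilityMeasure_of_positive {K : Type*} [TopologicalSpace K] [CompactSpace K]
    [T2Space K] [MeasurableSpace K] [BorelSpace K] (L : C(K, ℝ) →ₗ[ℝ] ℝ)
    (hL : ∀ w, 0 ≤ w → 0 ≤ L w) (h1 : L 1 = 1) :
    ∃ π : ProbabilityMeasure K, ∀ w : C(K, ℝ), ∫ x, w x ∂(π : Measure K) = L w := by
  let toC : C_c(K, ℝ) →ₗ[ℝ] C(K, ℝ) :=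
    { toFun := fun f => f.toContinuousMap
      map_add' := fun _ _ => rfl
      map_smul' := fun _ _ => rfl }
  let Λ : C_c(K, ℝ) →ₚ[ℝ] ℝ := PositiveLinearMap.mk₀ (L ∘ₗ toC) fun f hf => hL _ fun x => hf x
  have hΛ : ∀ w : C(K, ℝ), ∫ x, w x ∂(RealRMK.rieszMeasure Λ) = L w := fun w =>
    RealRMK.integral_rieszMeasure Λ (CompactlySupportedContinuousMap.continuousMapEquiv w)
  have hp : IsProbabilityMeasure (RealRMK.rieszMeasure Λ) := by
    have h := hΛ 1
    simp only [ContinuousMap.one_apply, integral_const, smul_eq_mul, mul_one, h1] at h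
    exact ⟨by simpa [measureReal_def, ENNReal.toReal_eq_one_iff] using h⟩
  exact ⟨⟨_, hp⟩, hΛ⟩

/-- Hahn–Banach in superhedging form: if a cone of pairs (function, price) contains the constants
at their face value and prices nonnegative functions nonnegatively, then some probability measure
prices every function in the cone below its price. -/
theorem exists_probabilityMeasure_of_cone {K : Type*} [TopologicalSpace K] [CompactSpace K]
    [T2Space K] [MeasurableSpace K] [BorelSpace K] (D : Set (C(K, ℝ) × ℝ))
    (add : ∀ x ∈ D, ∀ y ∈ D, x + y ∈ D) (smul : ∀ r : ℝ, 0 ≤ r → ∀ x ∈ D, r • x ∈ D)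
    (one : (1, 1) ∈ D) (neg_one : (-1, -1) ∈ D) (nonneg : ∀ x ∈ D, 0 ≤ x.1 → 0 ≤ x.2) :
    ∃ π : ProbabilityMeasure K, ∀ x ∈ D, ∫ k, x.1 k ∂(π : Measure K) ≤ x.2 := by
  have zero : (0 : C(K, ℝ) × ℝ) ∈ D := by simpa using smul 0 le_rfl _ one
  -- A pair (w, t) lies in `s` when the budget t pays for some x in `D` that makes w + x.1
  -- nonnegative. The hypothesis `nonneg` says that (0, t) ↦ t is nonnegative on `s`; a positive
  -- extension of this functional yields the measure.
  let s : PointedCone ℝ (C(K, ℝ) × ℝ) :=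
    { carrier := {w | ∃ x ∈ D, -x.1 ≤ w.1 ∧ x.2 ≤ w.2}
      add_mem' := by
        rintro w w' ⟨x, hx, h1, h2⟩ ⟨x', hx', h1', h2'⟩
        refine ⟨x + x', add x hx x' hx', ?_, add_le_add h2 h2'⟩
        rw [Prod.fst_add, neg_add]
        exact add_le_add h1 h1'
      zero_mem' := ⟨0, zero, by simp, le_rfl⟩
      smul_mem' := by
        rintro r w ⟨x, hx, h1, h2⟩
        refine ⟨(r : ℝ) • x, smul _ r.2 x hx, ?_, ?_⟩
        · intro k
          have h : (r : ℝ) * (-x.1) k ≤ r * w.1 k := mul_le_mul_of_nonneg_left (h1 k) r.2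
          rw [ContinuousMap.neg_apply, mul_neg] at h
          exact h
        · exact mul_le_mul_of_nonneg_left h2 r.2 }
  let f : (C(K, ℝ) × ℝ) →ₗ.[ℝ] ℝ :=
    ⟨LinearMap.range (LinearMap.inr ℝ C(K, ℝ) ℝ), (LinearMap.snd ℝ C(K, ℝ) ℝ).domRestrict _⟩
  obtain ⟨g, hgf, hgs⟩ := riesz_extension s f
    (by
      rintro ⟨_, t, rfl⟩ ⟨x, hx, h1, h2⟩
      have h1' : -x.1 ≤ 0 := h1
      exact (nonneg x hx (neg_nonpos.1 h1')).trans h2)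
    (by
      rintro ⟨w, t⟩
      -- Moving the budget from t to ‖w‖ pays for the constant ‖w‖, which offsets w.
      refine ⟨⟨(0, ‖w‖ - t), ⟨_, rfl⟩⟩, (‖w‖ • (1, 1)), smul _ (norm_nonneg _) _ one, ?_, ?_⟩
      · intro k
        have := (abs_le.1 (w.norm_coe_le_norm k)).1
        simpa using this
      · simp)
  have hg2 : ∀ t : ℝ, g (0, t) = t := fun t => hgf ⟨(0, t), ⟨t, rfl⟩⟩
  let L : C(K, ℝ) →ₗ[ℝ] ℝ := g ∘ₗ LinearMap.inl ℝ C(K, ℝ) ℝ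
  have hsplit : ∀ w t, g (w, t) = L w + t := by
    intro w t
    have : ((w, t) : C(K, ℝ) × ℝ) = (w, 0) + (0, t) := by simp
    rw [this, map_add, hg2]
    rfl
  have hLD : ∀ x ∈ D, L x.1 ≤ x.2 := by
    intro x hx
    have h := hgs (-x.1, x.2) ⟨x, hx, le_rfl, le_rfl⟩
    rw [hsplit, map_neg] at h
    linarith
  have hL : ∀ w, 0 ≤ w → 0 ≤ L w := by
    intro w hw
    have h := hgs (w, 0) ⟨0, zero, by simpa using hw, le_rfl⟩
    rw [hsplit] at h
    linarith
  have hL1 : L 1 = 1 := by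
    have h1 : L 1 ≤ 1 := hLD _ one
    have h2 : L (-1) ≤ -1 := hLD _ neg_one
    rw [map_neg] at h2
    linarith
  obtain ⟨π, hπ⟩ := exists_probabilityMeasure_of_positive L hL hL1
  exact ⟨π, fun x hx => (hπ x.1).trans_le (hLD x hx)⟩

end ManyToOne

/-! ### Majorization as the convex order -/

namespace ManyToOne

theorem integrable_of_continuous {K : Type*} [TopologicalSpace K] [CompactSpace K]
    [MeasurableSpace K] [OpensMeasurableSpace K] {μ : Measure K} [IsFiniteMeasure μ]
    {f : K → ℝ} (hf : Continuous f) : Integrable f μ := by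
  obtain ⟨C, hC⟩ := (isCompact_range hf).isBounded.exists_norm_le
  exact Integrable.of_bound hf.aestronglyMeasurable C
    (Filter.Eventually.of_forall fun x => hC _ (mem_range_self x))

variable {c d : ℝ}

theorem cdfOn_eq (H : Measure (Icc c d)) [IsProbabilityMeasure H] (t : ℝ) :
    cdfOn H t = ∫ z : Icc c d, (Ici (z : ℝ)).indicator (fun _ => (1 : ℝ)) t ∂H := by
  have : IsProbabilityMeasure (H.map ((↑) : Icc c d → ℝ)) :=
    Measure.isProbabilityMeasure_map measurable_subtype_coe.aemeasurable
  have hS : MeasurableSet {z : Icc c d | (z : ℝ) ≤ t} :=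
    measurableSet_le measurable_subtype_coe measurable_const
  rw [cdfOn, cdf_eq_real, map_measureReal_apply measurable_subtype_coe measurableSet_Iic]
  have h : (fun z : Icc c d => (Ici (z : ℝ)).indicator (fun _ => (1 : ℝ)) t) =
      {z : Icc c d | (z : ℝ) ≤ t}.indicator (fun _ => (1 : ℝ)) := by
    funext z
    simp [indicator]
  rw [h, integral_indicator hS]
  simp
  rfl

/-- The integrated cdf is the integral of a hinge function. -/
theorem integral_cdfOn (H : Measure (Icc c d)) [IsProbabilityMeasure H] {y : ℝ} (hy : c ≤ y) :
    ∫ t in c..y, cdfOn H t = ∫ z : Icc c d, max (y - z) 0 ∂H := by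
  rw [intervalIntegral.integral_of_le hy, ← integral_Icc_eq_integral_Ioc]
  simp_rw [cdfOn_eq]
  -- Fubini: for fixed z the integral over t is the length of [z, y], the positive part of y - z.
  rw [integral_integral_swap]
  · congr 1
    funext z
    rw [integral_indicator measurableSet_Ici, Measure.restrict_restrict measurableSet_Ici]
    have : Ici (z : ℝ) ∩ Icc c y = Icc (z : ℝ) y := by
      ext t
      simp only [mem_inter_iff, mem_Ici, mem_Icc]
      have := z.2.1
      constructor
      · rintro ⟨h1, h2, h3⟩; exact ⟨h1, h3⟩
      · rintro ⟨h1, h3⟩; exact ⟨h1, this.trans h1, h3⟩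
    rw [this]
    simp [measureReal_def, ENNReal.toReal_ofReal']
  · have hm : MeasurableSet {w : ℝ × Icc c d | (w.2 : ℝ) ≤ w.1} :=
      measurableSet_le (measurable_subtype_coe.comp measurable_snd) measurable_fst
    refine Integrable.of_bound (C := 1) ?_ (Filter.Eventually.of_forall ?_)
    · have h : (Function.uncurry fun (t : ℝ) (z : Icc c d) =>
          (Ici (z : ℝ)).indicator (fun _ => (1 : ℝ)) t) =
          {w : ℝ × Icc c d | (w.2 : ℝ) ≤ w.1}.indicator (fun _ => (1 : ℝ)) := by
        funext w
        simp [indicator, Function.uncurry]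
      rw [h]
      exact (measurable_const.indicator hm).aestronglyMeasurable
    · rintro ⟨t, z⟩
      by_cases h : (z : ℝ) ≤ t <;> simp [indicator, h]

/-- At the upper end point the hinge d - z is affine on [c, d], so equality of the integrated cdfs
there means equality of the means. -/
theorem majorizes_iff {H G : Measure (Icc c d)} [IsProbabilityMeasure H] [IsProbabilityMeasure G]
    (hcd : c ≤ d) :
    Majorizes H G ↔
      (∀ t ∈ Icc c d, ∫ z : Icc c d, max (t - z) 0 ∂H ≤ ∫ z : Icc c d, max (t - z) 0 ∂G) ∧
        ∫ z : Icc c d, (z : ℝ) ∂H = ∫ z : Icc c d, (z : ℝ) ∂G := by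
  have key : ∀ (μ : Measure (Icc c d)) [IsProbabilityMeasure μ],
      ∫ t in c..d, cdfOn μ t = d - ∫ z : Icc c d, (z : ℝ) ∂μ := by
    intro μ _
    rw [integral_cdfOn μ hcd]
    have : ∀ z : Icc c d, max (d - z) 0 = d - (z : ℝ) := fun z => max_eq_left (sub_nonneg.2 z.2.2)
    simp_rw [this]
    rw [integral_sub (integrable_const _) (integrable_of_continuous continuous_subtype_val)]
    simp
  unfold Majorizes
  rw [key H, key G, sub_right_inj]
  refine and_congr_left fun _ => forall₂_congr fun t ht => ?_
  rw [integral_cdfOn H ht.1, integral_cdfOn G ht.1]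

/-- Since (z - t)⁺ = (t - z)⁺ + (z - t) and the means agree, left and right hinges satisfy the same
inequality. Right hinges are the ones used to build interpolants from left to right. -/
theorem integral_hinge_le {H G : Measure (Icc c d)} [IsProbabilityMeasure H]
    [IsProbabilityMeasure G] (hcd : c ≤ d) (h : Majorizes H G) {t : ℝ} (ht : t ∈ Icc c d) :
    ∫ z : Icc c d, max (z - t) 0 ∂H ≤ ∫ z : Icc c d, max (z - t) 0 ∂G := by
  obtain ⟨h1, h2⟩ := (majorizes_iff hcd).1 h
  have key : ∀ (μ : Measure (Icc c d)) [IsProbabilityMeasure μ],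
      ∫ z : Icc c d, max (z - t) 0 ∂μ =
        ∫ z : Icc c d, max (t - z) 0 ∂μ + ((∫ z : Icc c d, (z : ℝ) ∂μ) - t) := by
    intro μ _
    have e : ∀ z : Icc c d, max ((z : ℝ) - t) 0 = max (t - z) 0 + (z - t) := by
      intro z
      rcases le_total (z : ℝ) t with h | h
      · rw [max_eq_right (by linarith), max_eq_left (by linarith)]; ring
      · rw [max_eq_left (by linarith), max_eq_right (by linarith)]; ring
    simp_rw [e]
    rw [integral_add (integrable_of_continuous (by fun_prop))
        (integrable_of_continuous (by fun_prop)),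
      integral_sub (integrable_of_continuous (by fun_prop)) (integrable_const _)]
    simp
  rw [key H, key G, h2]
  linarith [h1 t ht]

/-- Piecewise linear interpolation on a uniform grid, built from hinge functions. -/
theorem exists_interpolation {H G : Measure (Icc c d)} [IsProbabilityMeasure H]
    [IsProbabilityMeasure G] (hcd : c < d) (hHG : Majorizes H G) {k : ℝ → ℝ} {C δ : ℝ}
    (hk : ∀ x y, |k x - k y| ≤ C * |x - y|) (hδ : 0 < δ) (n : ℕ) (hn : c + (n + 1) * δ ≤ d)
    (hconv : ∀ t, c ≤ t → t + 2 * δ ≤ d → 2 * k (t + δ) ≤ k t + k (t + 2 * δ)) :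
    ∃ f : ℝ → ℝ, Continuous f ∧ (∫ z : Icc c d, f z ∂H ≤ ∫ z : Icc c d, f z ∂G) ∧
      (∀ y, c + n * δ ≤ y → f y = k (c + n * δ) +
        (k (c + (n + 1) * δ) - k (c + n * δ)) / δ * (y - (c + n * δ))) ∧
      ∀ y, c ≤ y → y ≤ c + (n + 1) * δ → |f y - k y| ≤ 2 * C * δ := by
  -- Within a cell of width δ, the chord and k each move at most Cδ away from k t.
  have near : ∀ t y : ℝ, t ≤ y → y ≤ t + δ →
      |k t + (k (t + δ) - k t) / δ * (y - t) - k y| ≤ 2 * C * δ := by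
    intro t y h1 h2
    have a1 := hk t y
    have a2 := hk (t + δ) t
    rw [add_sub_cancel_left, abs_of_pos hδ] at a2
    have hC : 0 ≤ C := by
      have := (abs_nonneg _).trans a2
      exact nonneg_of_mul_nonneg_left this hδ
    have a3 : |(k (t + δ) - k t) / δ * (y - t)| ≤ C * δ := by
      rw [abs_mul, abs_div, abs_of_pos hδ, abs_of_nonneg (sub_nonneg.2 h1)]
      have : |k (t + δ) - k t| / δ ≤ C := (div_le_iff₀ hδ).2 a2
      exact mul_le_mul this (by linarith) (by linarith) hC
    have a4 : |k t - k y| ≤ C * δ := by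
      refine a1.trans (mul_le_mul_of_nonneg_left ?_ hC)
      rw [abs_sub_comm, abs_of_nonneg (sub_nonneg.2 h1)]
      linarith
    calc _ = |(k t - k y) + (k (t + δ) - k t) / δ * (y - t)| := by congr 1; ring
      _ ≤ _ := (abs_add_le _ _).trans (by linarith)
  induction n with
  | zero =>
    refine ⟨fun y => k c + (k (c + δ) - k c) / δ * (y - c), by fun_prop, ?_, ?_, ?_⟩
    -- The first interpolant is affine, so equal means give equal integrals.
    · obtain ⟨-, h2⟩ := (majorizes_iff hcd.le).1 hHG
      have key : ∀ (μ : Measure (Icc c d)) [IsProbabilityMeasure μ],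
          ∫ z : Icc c d, (k c + (k (c + δ) - k c) / δ * (z - c)) ∂μ =
            k c + (k (c + δ) - k c) / δ * ((∫ z : Icc c d, (z : ℝ) ∂μ) - c) := by
        intro μ _
        rw [integral_add (integrable_const _) (integrable_of_continuous (by fun_prop)),
          integral_const_mul,
          integral_sub (integrable_of_continuous (by fun_prop)) (integrable_const _)]
        simp
      rw [key H, key G, h2]
    · intro y _
      simp
    · intro y h1 h2
      exact near c y h1 (by simpa using h2)
  | succ n ih =>
    push_cast at hn ⊢
    obtain ⟨f, hf, hint, hright, happ⟩ := ih (by linarith)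
    set t := c + ((n : ℝ) + 1) * δ with ht
    have e0 : c + (n : ℝ) * δ = t - δ := by rw [ht]; ring
    have e2 : c + ((n : ℝ) + 1 + 1) * δ = t + δ := by rw [ht]; ring
    rw [e0] at hright
    rw [e2] at hn ⊢
    have hct : c + δ ≤ t := by
      rw [ht]; have : 0 ≤ (n : ℝ) * δ := by positivity
      linarith
    have hc2 := hconv (t - δ) (by linarith) (by linarith)
    rw [sub_add_cancel, show t - δ + 2 * δ = t + δ by ring] at hc2
    -- The jump in chord slope at t. Adding γ (y - t)⁺ bends the last segment, which f continues
    -- affinely past t, onto the next chord; convexity gives γ ≥ 0, so the integral inequality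
    -- persists.
    set γ := (k (t + δ) - k t) / δ - (k t - k (t - δ)) / δ with hγ
    have hγ0 : 0 ≤ γ := by
      rw [hγ, ← sub_div]
      exact div_nonneg (by linarith) hδ.le
    refine ⟨fun y => f y + γ * max (y - t) 0, by fun_prop, ?_, ?_, ?_⟩
    · have key : ∀ (μ : Measure (Icc c d)) [IsProbabilityMeasure μ],
          ∫ z : Icc c d, (f z + γ * max (z - t) 0) ∂μ =
            ∫ z : Icc c d, f z ∂μ + γ * ∫ z : Icc c d, max (z - t) 0 ∂μ := by
        intro μ _
        rw [integral_add (integrable_of_continuous (by fun_prop))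
          (integrable_of_continuous (by fun_prop)), integral_const_mul]
      rw [key H, key G]
      have := integral_hinge_le hcd.le hHG (t := t) ⟨by linarith, by linarith⟩
      exact add_le_add hint (mul_le_mul_of_nonneg_left this hγ0)
    · intro y hy
      simp only
      rw [hright y (by linarith), max_eq_left (by linarith), hγ]
      field_simp
      ring
    · intro y h1 h2
      rcases le_total y t with h | h
      · simp only
        rw [max_eq_right (by linarith), mul_zero, add_zero]
        exact happ y h1 h
      · have := near t y h h2
        simp only
        rw [hright y (by linarith), max_eq_left (by linarith), hγ]
        convert this using 2
        field_simp
        ring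

/-- Majorization is the convex order: convex Lipschitz functions have a smaller integral against
the majorizing distribution. -/
theorem Majorizes.integral_le {H G : Measure (Icc c d)} [IsProbabilityMeasure H]
    [IsProbabilityMeasure G] (hcd : c < d) (hHG : Majorizes H G) {k : Icc c d → ℝ}
    (hk : IsLip k) (hc : IsConv k) : ∫ z, k z ∂H ≤ ∫ z, k z ∂G := by
  obtain ⟨C, hC⟩ := hk
  -- The extension by constants stays Lipschitz, but convexity may fail outside [c, d]; hence the
  -- range restrictions in `hconv`.
  let e : ℝ → ℝ := fun t => k (projIcc c d hcd.le t)
  have he : LipschitzWith (C * 1) e := hC.comp (LipschitzWith.projIcc hcd.le)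
  have hle : ∀ x y, |e x - e y| ≤ C * |x - y| := by
    intro x y
    have := he.dist_le_mul x y
    simpa [Real.dist_eq] using this
  have hek : ∀ z : Icc c d, e z = k z := fun z => by simp [e]
  have hconv : ∀ δ > 0, ∀ t, c ≤ t → t + 2 * δ ≤ d → 2 * e (t + δ) ≤ e t + e (t + 2 * δ) := by
    intro δ hδ t h1 h2
    have m0 : t ∈ Icc c d := ⟨h1, by linarith⟩
    have m1 : t + δ ∈ Icc c d := ⟨by linarith, by linarith⟩
    have m2 : t + 2 * δ ∈ Icc c d := ⟨by linarith, by linarith⟩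
    have := hc ⟨_, m0⟩ ⟨_, m2⟩ ⟨_, m1⟩ (1 / 2) (1 / 2) (by norm_num) (by norm_num) (by norm_num)
      (by simp only; ring)
    rw [← hek, ← hek, ← hek] at this
    simp only at this
    linarith
  -- With n + 1 cells of width δ = (d - c)/(n + 1), the interpolation error 2Cδ is paid once under H
  -- and once under G.
  have bound : ∀ n : ℕ, ∫ z, k z ∂H ≤ ∫ z, k z ∂G + 4 * C * (d - c) * (1 / ((n : ℝ) + 1)) := by
    intro n
    have hn : (0 : ℝ) < n + 1 := by positivity
    set δ := (d - c) / ((n : ℝ) + 1) with hδ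
    have hδ0 : 0 < δ := div_pos (by linarith) hn
    have hend : c + ((n : ℝ) + 1) * δ = d := by rw [hδ]; field_simp; ring
    obtain ⟨f, hf, hint, -, happ⟩ := exists_interpolation hcd hHG hle hδ0 n hend.le (hconv δ hδ0)
    have hfz : Continuous fun z : Icc c d => f z := by fun_prop
    have hab : ∀ z : Icc c d, |f z - k z| ≤ 2 * C * δ := by
      intro z
      rw [← hek]
      exact happ z z.2.1 (by rw [hend]; exact z.2.2)
    have i1 : ∫ z, k z ∂H ≤ ∫ z : Icc c d, f z ∂H + 2 * C * δ := by
      have := integral_mono (μ := H) (integrable_of_continuous hC.continuous)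
        (integrable_of_continuous (hfz.add continuous_const) : Integrable _ H)
        (fun z => show k z ≤ f z + 2 * C * δ by linarith [(abs_le.1 (hab z)).1])
      rw [integral_add' (integrable_of_continuous hfz) (integrable_const _)] at this
      simpa using this
    have i2 : ∫ z : Icc c d, f z ∂G ≤ ∫ z, k z ∂G + 2 * C * δ := by
      have := integral_mono (μ := G) (integrable_of_continuous hfz)
        (integrable_of_continuous (hC.continuous.add continuous_const) : Integrable _ G)
        (fun z => show f z ≤ k z + 2 * C * δ by linarith [(abs_le.1 (hab z)).2])
      rw [integral_add' (integrable_of_continuous hC.continuous) (integrable_const _)] at this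
      simpa using this
    have : 4 * C * (d - c) * (1 / ((n : ℝ) + 1)) = 2 * C * δ + 2 * C * δ := by rw [hδ]; ring
    linarith
  have lim := (tendsto_one_div_add_atTop_nhds_zero_nat (𝕜 := ℝ)).const_mul (4 * C * (d - c))
  have lim' := lim.const_add (∫ z, k z ∂G)
  rw [mul_zero, add_zero] at lim'
  exact ge_of_tendsto' lim' bound

end ManyToOne

/-! ### Strassen's theorem: splitting is equivalent to majorization -/

namespace ManyToOne

/-- A pointwise supremum of functions with a common Lipschitz constant is Lipschitz. -/
theorem lipschitzWith_iSup {ι α : Type*} [Nonempty ι] [PseudoMetricSpace α] {φ : ι → α → ℝ}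
    {C : NNReal} (hφ : ∀ i, LipschitzWith C (φ i)) (hb : ∀ x, BddAbove (range fun i => φ i x)) :
    LipschitzWith C fun x => ⨆ i, φ i x := by
  refine LipschitzWith.of_le_add_mul C fun x y => ciSup_le fun i => ?_
  have := (hφ i).le_add_mul x y
  linarith [le_ciSup (hb y) i]

theorem isConv_iSup {ι : Type*} [Nonempty ι] {c d : ℝ} {φ : ι → Icc c d → ℝ}
    (hφ : ∀ i, IsConv (φ i)) (hb : ∀ x, BddAbove (range fun i => φ i x)) :
    IsConv fun x => ⨆ i, φ i x := by
  intro y z w s t hs ht hst hw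
  refine ciSup_le fun i => (hφ i y z w s t hs ht hst hw).trans ?_
  exact add_le_add (mul_le_mul_of_nonneg_left (le_ciSup (hb y) i) hs)
    (mul_le_mul_of_nonneg_left (le_ciSup (hb z) i) ht)

theorem isConv_affine {c d : ℝ} (α β : ℝ) : IsConv fun y : Icc c d => α + β * y := by
  intro y z w s t _ _ hst hw
  have : t = 1 - s := by linarith
  subst this
  simp only [hw]
  exact le_of_eq (by ring)

variable {c d : ℝ}

/-- The identity embedding of probability measures into measures, as a kernel. -/
noncomputable def evalKernel (K : Type*) [MeasurableSpace K] : Kernel (ProbabilityMeasure K) K :=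
  ⟨fun η => (η : Measure K), measurable_subtype_coe⟩

instance (K : Type*) [MeasurableSpace K] : IsMarkovKernel (evalKernel K) :=
  ⟨fun η => inferInstanceAs (IsProbabilityMeasure (η : Measure K))⟩

theorem measurable_integral_eval {f : Icc c d → ℝ} (hf : Continuous f) :
    Measurable fun η : ProbabilityMeasure (Icc c d) => ∫ y, f y ∂(η : Measure (Icc c d)) :=
  (StronglyMeasurable.integral_kernel (κ := evalKernel (Icc c d)) hf.stronglyMeasurable).measurable

theorem measurable_workforceMean : Measurable (workforceMean (c := c) (d := d)) :=
  (measurable_integral_eval continuous_subtype_val).subtype_mk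

/-- The barycentre G is the composition of `evalKernel` with the constant kernel τ, so the
barycentre identity passes from sets to continuous integrands. -/
theorem integral_integral_eval {τ : Measure (ProbabilityMeasure (Icc c d))} [IsProbabilityMeasure τ]
    {G : Measure (Icc c d)} (hG : ∀ s : Set (Icc c d), MeasurableSet s →
      ∫⁻ η, (η : Measure (Icc c d)) s ∂τ = G s) {f : Icc c d → ℝ} (hf : Continuous f) :
    ∫ η, ∫ y, f y ∂(η : Measure (Icc c d)) ∂τ = ∫ y, f y ∂G := by
  have hcomp : (evalKernel (Icc c d) ∘ₖ Kernel.const Unit τ) () = G := by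
    ext s hs
    rw [Kernel.comp_apply' _ _ _ hs]
    exact hG s hs
  have h := Kernel.integral_comp (η := evalKernel (Icc c d)) (κ := Kernel.const Unit τ) (a := ())
    (integrable_of_continuous hf)
  rw [hcomp] at h
  exact h.symm

/-- The distribution of means of a splitting majorizes. -/
theorem ObtainedBySplitting.majorizes {H : Measure (Icc c d)} {G : ProbabilityMeasure (Icc c d)}
    (hcd : c ≤ d) (h : ObtainedBySplitting H G) : Majorizes H G := by
  obtain ⟨τ, hτ, hG, rfl⟩ := h
  have hmap : ∀ f : Icc c d → ℝ, Continuous f →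
      ∫ z, f z ∂(τ.map workforceMean) = ∫ η, f (workforceMean η) ∂τ := fun f hf =>
    integral_map measurable_workforceMean.aemeasurable hf.aestronglyMeasurable
  have : IsProbabilityMeasure (τ.map (workforceMean (c := c) (d := d))) :=
    Measure.isProbabilityMeasure_map measurable_workforceMean.aemeasurable
  rw [majorizes_iff hcd]
  constructor
  · intro t ht
    have hc : Continuous fun z : Icc c d => max (t - z) 0 := by fun_prop
    rw [hmap _ hc, ← integral_integral_eval hG hc]
    have bdd : ∀ z : Icc c d, ‖max (t - z) 0‖ ≤ d - c := by
      intro z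
      rw [Real.norm_of_nonneg (le_max_right _ _)]
      have := z.2.1
      exact max_le (by linarith [ht.2]) (by linarith)
    refine integral_mono ?_ ?_ fun η => ?_
    · exact Integrable.of_bound (hc.measurable.comp measurable_workforceMean).aestronglyMeasurable
        (d - c) (Filter.Eventually.of_forall fun η => bdd _)
    · refine Integrable.of_bound (measurable_integral_eval hc).aestronglyMeasurable
        (d - c) (Filter.Eventually.of_forall fun η => ?_)
      simpa using norm_integral_le_of_norm_le_const (μ := (η : Measure (Icc c d)))
        (Filter.Eventually.of_forall bdd)
    -- Jensen for the hinge: it dominates both t - z and 0, so its mean dominates the maximum of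
    -- their means.
    · have i1 : Integrable (fun z : Icc c d => (z : ℝ)) (η : Measure (Icc c d)) :=
        integrable_of_continuous continuous_subtype_val
      refine max_le ?_ (integral_nonneg fun z => le_max_right _ _)
      have h2 : t - (workforceMean η : ℝ) = ∫ z : Icc c d, (t - z) ∂(η : Measure (Icc c d)) := by
        rw [integral_sub (integrable_const _) i1]
        simp [workforceMean]
      rw [h2]
      exact integral_mono ((integrable_const _).sub i1) (integrable_of_continuous hc)
        fun z => le_max_left _ _
  · rw [hmap _ continuous_subtype_val, ← integral_integral_eval hG continuous_subtype_val]
    rfl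

/-- Strassen's theorem on an interval, as a martingale coupling. -/
theorem Majorizes.exists_coupling {H G : ProbabilityMeasure (Icc c d)} (hcd : c < d)
    (h : Majorizes (H : Measure (Icc c d)) G) :
    ∃ π : ProbabilityMeasure (Icc c d × Icc c d),
      (π : Measure (Icc c d × Icc c d)).fst = H ∧ (π : Measure (Icc c d × Icc c d)).snd = G ∧
      ∀ ξ : C(Icc c d, ℝ), ∫ w, ξ w.1 * (w.2 - w.1) ∂(π : Measure (Icc c d × Icc c d)) = 0 := by
  have : Nonempty (Icc c d) := ⟨⟨c, left_mem_Icc.2 hcd.le⟩⟩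
  -- In w = (z, y) the mean z has law H and the skill y has law G. The terms g and h encode the
  -- marginals; the term in ξ, priced at zero, encodes E[y | z] = z.
  let D : Set (C(Icc c d × Icc c d, ℝ) × ℝ) := {x | ∃ g h ξ : C(Icc c d, ℝ),
    (∀ w, x.1 w = g w.2 + h w.1 + ξ w.1 * (w.2 - w.1)) ∧
      x.2 = ∫ y, g y ∂(G : Measure (Icc c d)) + ∫ z, h z ∂(H : Measure (Icc c d))}
  have hint : ∀ (μ : ProbabilityMeasure (Icc c d)) (f : C(Icc c d, ℝ)),
      Integrable f (μ : Measure (Icc c d)) := fun μ f => integrable_of_continuous f.continuous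
  obtain ⟨π, hπ⟩ := exists_probabilityMeasure_of_cone D
    (by
      rintro x ⟨g, h, ξ, h1, h2⟩ x' ⟨g', h', ξ', h1', h2'⟩
      refine ⟨g + g', h + h', ξ + ξ', fun w => ?_, ?_⟩
      · simp only [Prod.fst_add, ContinuousMap.add_apply, h1, h1']
        ring
      · simp only [Prod.snd_add, ContinuousMap.add_apply, h2, h2']
        rw [integral_add (hint _ _) (hint _ _), integral_add (hint _ _) (hint _ _)]
        ring)
    (by
      rintro r - x ⟨g, h, ξ, h1, h2⟩
      refine ⟨r • g, r • h, r • ξ, fun w => ?_, ?_⟩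
      · simp only [Prod.smul_fst, ContinuousMap.smul_apply, smul_eq_mul, h1]
        ring
      · simp only [Prod.smul_snd, ContinuousMap.smul_apply, smul_eq_mul, h2, integral_const_mul]
        ring)
    ⟨1, 0, 0, fun w => by simp, by simp⟩
    ⟨-1, 0, 0, fun w => by simp, by simp⟩
    (by
      rintro x ⟨g, f, ξ, h1, h2⟩ hx
      -- Nonnegativity says that each affine function y ↦ -f z - ξ z (y - z) lies below g. Their
      -- supremum over z is convex and Lipschitz, lies below g, and lies above -f (take y = z);
      -- integrating and using majorization gives -E_H[f] ≤ E_G[g].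
      let φ : Icc c d → Icc c d → ℝ := fun z y => (-f z + ξ z * z) + (-ξ z) * y
      have hφg : ∀ z y, φ z y ≤ g y := by
        intro z y
        have : 0 ≤ x.1 (z, y) := hx (z, y)
        rw [h1] at this
        simp only at this
        simp only [φ]
        linarith
      have hb : ∀ y, BddAbove (range fun z => φ z y) := fun y =>
        ⟨g y, by rintro _ ⟨z, rfl⟩; exact hφg z y⟩
      have hlip : LipschitzWith ‖ξ‖₊ fun y => ⨆ z, φ z y := by
        refine lipschitzWith_iSup (fun z => LipschitzWith.of_dist_le_mul fun y y' => ?_) hb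
        simp only [φ, dist_add_left, Real.dist_eq, ← mul_sub, abs_mul, abs_neg]
        exact mul_le_mul_of_nonneg_right (ξ.norm_coe_le_norm z) (abs_nonneg _)
      have hconv : IsConv fun y => ⨆ z, φ z y := isConv_iSup (fun z => isConv_affine _ _) hb
      have i1 := integrable_of_continuous (μ := (G : Measure (Icc c d))) hlip.continuous
      have i2 := integrable_of_continuous (μ := (H : Measure (Icc c d))) hlip.continuous
      have s1 := h.integral_le hcd ⟨_, hlip⟩ hconv
      have s2 := integral_mono i1 (hint G g) fun y => ciSup_le fun z => hφg z y
      have s3 := integral_mono (hint H f).neg i2 fun z =>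
        show -f z ≤ _ from le_trans (by simp [φ]) (le_ciSup (hb z) z)
      rw [integral_neg'] at s3
      rw [h2]
      linarith)
  have hp : ∀ g h ξ : C(Icc c d, ℝ),
      ∫ w, g w.2 + h w.1 + ξ w.1 * (w.2 - w.1) ∂(π : Measure (Icc c d × Icc c d)) ≤
        ∫ y, g y ∂(G : Measure (Icc c d)) + ∫ z, h z ∂(H : Measure (Icc c d)) := fun g h ξ =>
    hπ (⟨fun w => g w.2 + h w.1 + ξ w.1 * (w.2 - w.1), by fun_prop⟩, _)
      ⟨g, h, ξ, fun _ => rfl, rfl⟩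
  -- Each class of test functions is closed under negation, so the price bounds are equalities.
  refine ⟨π, ?_, ?_, ?_⟩
  · refine ext_of_forall_integral_eq_of_IsFiniteMeasure fun f => ?_
    rw [Measure.fst, integral_map measurable_fst.aemeasurable f.continuous.aestronglyMeasurable]
    have h1 := hp 0 f.toContinuousMap 0
    have h2 := hp 0 (-f.toContinuousMap) 0
    simp [integral_neg] at h1 h2
    linarith
  · refine ext_of_forall_integral_eq_of_IsFiniteMeasure fun f => ?_
    rw [Measure.snd, integral_map measurable_snd.aemeasurable f.continuous.aestronglyMeasurable]
    have h1 := hp f.toContinuousMap 0 0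
    have h2 := hp (-f.toContinuousMap) 0 0
    simp [integral_neg] at h1 h2
    linarith
  · intro ξ
    have h1 := hp 0 0 ξ
    have h2 := hp 0 0 (-ξ)
    simp [integral_neg] at h1 h2
    linarith

/-- If `m - id` is orthogonal to all continuous functions, then `m` is almost surely the identity. -/
theorem ae_eq_coe_of_integral_mul_eq {H : Measure (Icc c d)} [IsProbabilityMeasure H]
    {m : Icc c d → Icc c d} (hm : Measurable m)
    (h : ∀ ξ : C(Icc c d, ℝ), ∫ z, ξ z * ((m z : ℝ) - z) ∂H = 0) : m =ᵐ[H] id := by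
  -- Subtracting c turns m and the identity into nonnegative densities. The two measures they define
  -- agree on continuous functions, hence coincide, and so do the densities almost everywhere.
  have hmeas : ∀ f : Icc c d → Icc c d, Measurable f →
      Measurable fun z => ENNReal.ofReal ((f z : ℝ) - c) := fun f hf =>
    ((measurable_subtype_coe.comp hf).sub_const c).ennreal_ofReal
  have hi : ∀ f : Icc c d → Icc c d, Measurable f → ∀ ξ : C(Icc c d, ℝ),
      Integrable (fun z => ((f z : ℝ) - c) * ξ z) H := by
    intro f hf ξ
    refine Integrable.of_bound (C := (d - c) * ‖ξ‖) ?_ (Filter.Eventually.of_forall fun z => ?_)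
    · exact (((measurable_subtype_coe.comp hf).sub_const c).mul
        ξ.continuous.measurable).aestronglyMeasurable
    · rw [norm_mul, Real.norm_of_nonneg (sub_nonneg.2 (f z).2.1)]
      exact mul_le_mul (by linarith [(f z).2.2]) (ξ.norm_coe_le_norm z) (norm_nonneg _)
        (by linarith [(f z).2.1, (f z).2.2])
  have hfin : ∀ f : Icc c d → Icc c d,
      IsFiniteMeasure (H.withDensity fun z => ENNReal.ofReal ((f z : ℝ) - c)) := by
    intro f
    refine isFiniteMeasure_withDensity (ne_of_lt ?_)
    calc _ ≤ ∫⁻ _, ENNReal.ofReal (d - c) ∂H :=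
          lintegral_mono fun z => ENNReal.ofReal_le_ofReal (by linarith [(f z).2.2])
      _ < ⊤ := by simp
  have e : ∀ f : Icc c d → Icc c d, Measurable f → ∀ ξ : C(Icc c d, ℝ),
      ∫ z, ξ z ∂(H.withDensity fun z => ENNReal.ofReal ((f z : ℝ) - c)) =
        ∫ z, ((f z : ℝ) - c) * ξ z ∂H := by
    intro f hf ξ
    rw [integral_withDensity_eq_integral_toReal_smul (hmeas f hf) (by simp)]
    refine integral_congr_ae (Filter.Eventually.of_forall fun z => ?_)
    simp only [smul_eq_mul]
    rw [ENNReal.toReal_ofReal (sub_nonneg.2 (f z).2.1)]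
  have key : (H.withDensity fun z => ENNReal.ofReal ((m z : ℝ) - c)) =
      H.withDensity fun z => ENNReal.ofReal (((id z : Icc c d) : ℝ) - c) := by
    have := hfin m
    have := hfin id
    refine ext_of_forall_integral_eq_of_IsFiniteMeasure fun f => ?_
    refine (e m hm f.toContinuousMap).trans (Eq.trans ?_ (e id measurable_id f.toContinuousMap).symm)
    rw [← sub_eq_zero, ← integral_sub (hi _ hm _) (hi _ measurable_id _),
      ← h f.toContinuousMap]
    congr 1
    funext z
    simp only [id]
    ring
  rw [withDensity_eq_iff_of_sigmaFinite (hmeas m hm).aemeasurable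
    (hmeas id measurable_id).aemeasurable] at key
  filter_upwards [key] with z hz
  have := (ENNReal.ofReal_eq_ofReal_iff (sub_nonneg.2 (m z).2.1) (sub_nonneg.2 (id z).2.1)).1 hz
  exact Subtype.ext (by linarith)

/-- A majorizing distribution is the distribution of means of some splitting. -/
theorem Majorizes.obtainedBySplitting {H G : ProbabilityMeasure (Icc c d)} (hcd : c < d)
    (h : Majorizes (H : Measure (Icc c d)) G) : ObtainedBySplitting (H : Measure (Icc c d)) G := by
  have : Nonempty (Icc c d) := ⟨⟨c, left_mem_Icc.2 hcd.le⟩⟩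
  have : StandardBorelSpace (Icc c d) := measurableSet_Icc.standardBorel
  obtain ⟨π, hfst, hsnd, hmart⟩ := h.exists_coupling hcd
  set ρ := (π : Measure (Icc c d × Icc c d)) with hρ
  -- The workforce with label z is the conditional law of the skill given z. Its mean is z almost
  -- surely by the martingale property, and the splitting is the image of H under `κ`.
  let κ : Icc c d → ProbabilityMeasure (Icc c d) := fun z => ⟨ρ.condKernel z, inferInstance⟩
  have hκ : Measurable κ := ρ.condKernel.measurable.subtype_mk
  have hmean : (fun z => workforceMean (κ z)) =ᵐ[(H : Measure (Icc c d))] id := by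
    refine ae_eq_coe_of_integral_mul_eq (measurable_workforceMean.comp hκ) fun ξ => ?_
    rw [← hmart ξ, ← Measure.integral_condKernel (integrable_of_continuous (by fun_prop)), hfst]
    congr 1
    funext z
    simp only
    rw [integral_const_mul, integral_sub (integrable_of_continuous (by fun_prop))
      (integrable_const _)]
    simp [workforceMean, κ]
  refine ⟨(H : Measure (Icc c d)).map κ, Measure.isProbabilityMeasure_map hκ.aemeasurable, ?_, ?_⟩
  · intro s hs
    have hev : Measurable fun η : ProbabilityMeasure (Icc c d) => (η : Measure (Icc c d)) s :=
      (Measure.measurable_coe hs).comp measurable_subtype_coe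
    rw [lintegral_map hev hκ]
    have := Measure.setLIntegral_condKernel_eq_measure_prod (ρ := ρ) MeasurableSet.univ hs
    rw [setLIntegral_univ, hfst] at this
    rw [← hsnd, Measure.snd_apply hs, ← univ_prod]
    exact this
  · rw [Measure.map_map measurable_workforceMean hκ, 
      Measure.map_congr (show workforceMean ∘ κ =ᵐ[_] id from hmean), Measure.map_id]

end ManyToOne

/-! ### Dual attainment and strong duality -/

namespace ManyToOne

open scoped BoundedContinuousFunction

variable {a b c d : ℝ}

/-- The infimal convolution with `C * dist` is the largest `C`-Lipschitz minorant; it preserves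
convexity. -/
theorem exists_lipschitz_minorant [Nonempty (Icc c d)] (C : NNReal) {q : Icc c d → ℝ}
    (hq : Continuous q) (hconv : IsConv q) :
    ∃ r : Icc c d → ℝ, LipschitzWith C r ∧ IsConv r ∧ (∀ z, r z ≤ q z) ∧
      ∀ (s : ℝ) (z : Icc c d), (∀ y, s ≤ q y + C * dist z y) → s ≤ r z := by
  obtain ⟨B, hB⟩ := (isCompact_range hq).bddBelow
  have hb : ∀ z : Icc c d, BddBelow (range fun y => q y + C * dist z y) := by
    refine fun z => ⟨B, ?_⟩
    rintro _ ⟨y, rfl⟩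
    have h1 : B ≤ q y := hB (mem_range_self y)
    have : 0 ≤ C * dist z y := by positivity
    simp only
    linarith
  refine ⟨fun z => ⨅ y, q y + C * dist z y, ?_, ?_, ?_, fun s z h => le_ciInf h⟩
  · refine LipschitzWith.of_le_add_mul C fun x y => ?_
    rw [← sub_le_iff_le_add]
    refine le_ciInf fun z => ?_
    have h1 := ciInf_le (hb x) z
    have h2 := mul_le_mul_of_nonneg_left (dist_triangle x y z) C.2
    simp only [NNReal.val_eq_coe] at h1 h2
    linarith
  · intro y z w s t hs ht hst hw
    simp only
    rw [Real.mul_iInf_of_nonneg hs, Real.mul_iInf_of_nonneg ht]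
    -- Given candidates y' for y and z' for z, use s y' + t z' for w: q is convex and the distance
    -- is jointly convex.
    refine le_ciInf_add_ciInf fun y' z' => ?_
    have hmem : s * (y' : ℝ) + t * z' ∈ Icc c d :=
      (convex_Icc c d) y'.2 z'.2 hs ht hst
    refine (ciInf_le (hb w) ⟨_, hmem⟩).trans ?_
    have h1 := hconv y' z' ⟨_, hmem⟩ s t hs ht hst rfl
    have h2 : dist w ⟨_, hmem⟩ ≤ s * dist y y' + t * dist z z' := by
      simp only [Subtype.dist_eq, Real.dist_eq, hw]
      calc _ = |s * ((y : ℝ) - y') + t * ((z : ℝ) - z')| := by congr 1; ring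
        _ ≤ _ := (abs_add_le _ _).trans (by rw [abs_mul, abs_mul, abs_of_nonneg hs, abs_of_nonneg ht])
    have h3 := mul_le_mul_of_nonneg_left h2 C.2
    simp only [NNReal.val_eq_coe] at h3
    linarith
  · intro z
    simpa using ciInf_le (hb z) z

/-- Feasible continuous dual variables can be replaced, at no higher cost, by feasible ones which
inherit the Lipschitz constant of the production function and are uniformly bounded. -/
theorem exists_dual_improvement (hcd : c ≤ d) {v : Icc a b × Icc c d → ℝ} {C : NNReal}
    (hv : LipschitzWith C v) {M : ℝ} (hM : ∀ w, |v w| ≤ M)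
    (F : ProbabilityMeasure (Icc a b)) (G : ProbabilityMeasure (Icc c d))
    {p : Icc a b → ℝ} {q : Icc c d → ℝ} (hp : Continuous p) (hq : Continuous q) (hconv : IsConv q)
    (hpq : ∀ x z, v (x, z) ≤ p x + q z) :
    ∃ (p' : Icc a b → ℝ) (q' : Icc c d → ℝ), LipschitzWith C p' ∧ LipschitzWith C q' ∧
      IsConv q' ∧ (∀ x, |p' x| ≤ M + C * (d - c)) ∧ (∀ z, |q' z| ≤ C * (d - c)) ∧
      (∀ x z, v (x, z) ≤ p' x + q' z) ∧
      ∫ x, p' x ∂(F : Measure (Icc a b)) + ∫ y, q' y ∂(G : Measure (Icc c d)) ≤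
        ∫ x, p x ∂(F : Measure (Icc a b)) + ∫ y, q y ∂(G : Measure (Icc c d)) := by
  let z₀ : Icc c d := ⟨c, left_mem_Icc.2 hcd⟩
  have : Nonempty (Icc c d) := ⟨z₀⟩
  -- For each x, v (x, ·) - p x is C-Lipschitz and below q, hence below r, so feasibility survives.
  -- Normalizing r to vanish at z₀ bounds it; replacing p by the resulting maximal profit bounds
  -- that too. The constant r z₀ cancels in the objective because F and G have mass one.
  obtain ⟨r, hr, hrc, hrq, hrmax⟩ := exists_lipschitz_minorant C hq hconv
  have hpr : ∀ x z, v (x, z) ≤ p x + r z := by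
    intro x z
    have : v (x, z) - p x ≤ r z := by
      refine hrmax _ z fun y => ?_
      have h1 := hv.le_add_mul (x, z) (x, y)
      rw [Prod.dist_eq, dist_self, max_eq_right dist_nonneg] at h1
      linarith [hpq x y]
    linarith
  have hr0 : ∀ z, |r z - r z₀| ≤ C * (d - c) := by
    intro z
    have h1 := hr.dist_le_mul z z₀
    rw [Real.dist_eq] at h1
    refine h1.trans (mul_le_mul_of_nonneg_left ?_ C.2)
    rw [Subtype.dist_eq, Real.dist_eq, abs_of_nonneg (sub_nonneg.2 z.2.1)]
    linarith [z.2.2]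
  have hb1 : ∀ x z, v (x, z) - (r z - r z₀) ≤ M + C * (d - c) := fun x z => by
    linarith [(abs_le.1 (hM (x, z))).2, (abs_le.1 (hr0 z)).1]
  have hb : ∀ x, BddAbove (range fun z => v (x, z) - (r z - r z₀)) := fun x =>
    ⟨_, by rintro _ ⟨z, rfl⟩; exact hb1 x z⟩
  have hlip : LipschitzWith C fun x => ⨆ z, v (x, z) - (r z - r z₀) := by
    refine lipschitzWith_iSup (fun z => LipschitzWith.of_dist_le_mul fun x y => ?_) hb
    rw [dist_sub_right]
    refine (hv.dist_le_mul _ _).trans_eq ?_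
    rw [Prod.dist_eq, dist_self, max_eq_left dist_nonneg]
  have hlip' : LipschitzWith C fun z => r z - r z₀ :=
    LipschitzWith.of_dist_le_mul fun x y => by
      rw [dist_sub_right]
      exact hr.dist_le_mul x y
  refine ⟨fun x => ⨆ z, v (x, z) - (r z - r z₀), fun z => r z - r z₀, hlip, hlip', ?_, ?_, hr0,
    ?_, ?_⟩
  · intro y z w s t hs ht hst hw
    have h1 := hrc y z w s t hs ht hst hw
    have : s * r z₀ + t * r z₀ = r z₀ := by rw [← add_mul, hst, one_mul]
    simp only
    linarith
  · refine fun x => abs_le.2 ⟨?_, ciSup_le fun z => hb1 x z⟩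
    refine le_trans ?_ (le_ciSup (hb x) z₀)
    have : 0 ≤ (C : ℝ) * (d - c) := mul_nonneg C.2 (by linarith)
    simp only [sub_self, sub_zero]
    linarith [(abs_le.1 (hM (x, z₀))).1]
  · intro x z
    have := le_ciSup (hb x) z
    simp only at this ⊢
    linarith
  · have h1 : ∫ x, (⨆ z, v (x, z) - (r z - r z₀)) ∂(F : Measure (Icc a b)) ≤
        ∫ x, p x ∂(F : Measure (Icc a b)) + r z₀ := by
      have := integral_mono (μ := (F : Measure (Icc a b))) (integrable_of_continuous hlip.continuous)
        ((integrable_of_continuous hp).add (integrable_const (r z₀)))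
        (fun x => ciSup_le fun z => show _ ≤ p x + r z₀ by linarith [hpr x z])
      rw [integral_add' (integrable_of_continuous hp) (integrable_const _)] at this
      simpa using this
    have h2 := integral_mono (μ := (G : Measure (Icc c d)))
      (integrable_of_continuous hr.continuous) (integrable_of_continuous hq) hrq
    rw [integral_sub (integrable_of_continuous hr.continuous) (integrable_const _)]
    simp only [integral_const, probReal_univ, one_smul]
    linarith

theorem isCompact_lipschitz_bounded {α : Type*} [PseudoMetricSpace α] [CompactSpace α]
    (C : NNReal) (M : ℝ) :
    IsCompact {f : α →ᵇ ℝ | LipschitzWith C f ∧ ∀ x, |f x| ≤ M} := by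
  refine BoundedContinuousFunction.arzela_ascoli₂ (Icc (-M) M) isCompact_Icc _ ?_
    (fun f x hf => abs_le.1 (hf.2 x)) ?_
  · change IsClosed ({f : α →ᵇ ℝ | LipschitzWith C f} ∩ {f : α →ᵇ ℝ | ∀ x, |f x| ≤ M})
    simp only [lipschitzWith_iff_dist_le_mul, ofPred_forall]
    refine IsClosed.inter ?_ ?_
    · exact isClosed_iInter fun x => isClosed_iInter fun y => isClosed_le
        ((continuous_eval_const x).dist
          (continuous_eval_const y)) continuous_const
    · exact isClosed_iInter fun x => isClosed_le
        (continuous_eval_const x).abs continuous_const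
  · exact (LipschitzWith.uniformEquicontinuous _ C fun f => f.2.1).equicontinuous

theorem continuous_integral_boundedContinuous {α : Type*} [TopologicalSpace α] [MeasurableSpace α]
    [OpensMeasurableSpace α] (μ : Measure α) [IsProbabilityMeasure μ] :
    Continuous fun f : α →ᵇ ℝ => ∫ x, f x ∂μ := by
  refine (LipschitzWith.of_dist_le_mul (K := 1) fun f g => ?_).continuous
  rw [dist_eq_norm, ← integral_sub (f.integrable μ) (g.integrable μ)]
  simpa using norm_integral_le_of_norm_le_const (μ := μ) (f := fun x => f x - g x) (C := dist f g)
    (Filter.Eventually.of_forall fun x => by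
      rw [← dist_eq_norm]; exact BoundedContinuousFunction.dist_coe_le_dist x)

/-- The dual problem has a Lipschitz solution, optimal among all continuous dual variables. -/
theorem exists_dual_solution (hcd : c ≤ d) {v : Icc a b × Icc c d → ℝ} (hv : IsLip v)
    (F : ProbabilityMeasure (Icc a b)) (G : ProbabilityMeasure (Icc c d)) :
    ∃ (p : Icc a b → ℝ) (q : Icc c d → ℝ), DualFeasible v p q ∧
      ∀ (p' : Icc a b → ℝ) (q' : Icc c d → ℝ), Continuous p' → Continuous q' → IsConv q' →
        (∀ x z, v (x, z) ≤ p' x + q' z) →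
        ∫ x, p x ∂(F : Measure (Icc a b)) + ∫ y, q y ∂(G : Measure (Icc c d)) ≤
          ∫ x, p' x ∂(F : Measure (Icc a b)) + ∫ y, q' y ∂(G : Measure (Icc c d)) := by
  obtain ⟨C, hC⟩ := hv
  obtain ⟨M, hM⟩ := (isCompact_range hC.continuous).isBounded.exists_norm_le
  replace hM : ∀ w, |v w| ≤ M := fun w => hM _ (mem_range_self w)
  -- By `exists_dual_improvement` every continuous feasible pair is matched in `S` at no higher
  -- cost, so a minimum over this compact set is global.
  let S : Set ((Icc a b →ᵇ ℝ) × (Icc c d →ᵇ ℝ)) :=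
    ({f : Icc a b →ᵇ ℝ | LipschitzWith C f ∧ ∀ x, |f x| ≤ M + C * (d - c)} ×ˢ
      {f : Icc c d →ᵇ ℝ | LipschitzWith C f ∧ ∀ x, |f x| ≤ C * (d - c)}) ∩
      ({f | IsConv f.2} ∩ {f | ∀ x z, v (x, z) ≤ f.1 x + f.2 z})
  have ev1 : ∀ x, Continuous fun f : (Icc a b →ᵇ ℝ) × (Icc c d →ᵇ ℝ) => f.1 x := fun x =>
    (continuous_eval_const x).comp continuous_fst
  have ev2 : ∀ x, Continuous fun f : (Icc a b →ᵇ ℝ) × (Icc c d →ᵇ ℝ) => f.2 x := fun x =>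
    (continuous_eval_const x).comp continuous_snd
  have hS : IsCompact S := by
    refine ((isCompact_lipschitz_bounded C _).prod (isCompact_lipschitz_bounded C _)).inter_right
      (IsClosed.inter ?_ ?_)
    · simp only [IsConv, ofPred_forall]
      exact isClosed_iInter fun y => isClosed_iInter fun z => isClosed_iInter fun w =>
        isClosed_iInter fun s => isClosed_iInter fun t => isClosed_iInter fun _ =>
        isClosed_iInter fun _ => isClosed_iInter fun _ => isClosed_iInter fun _ =>
        isClosed_le (ev2 w) (((ev2 y).const_mul s).add ((ev2 z).const_mul t))
    · simp only [ofPred_forall]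
      exact isClosed_iInter fun x => isClosed_iInter fun z =>
        isClosed_le continuous_const ((ev1 x).add (ev2 z))
  have himp : ∀ (p' : Icc a b → ℝ) (q' : Icc c d → ℝ), Continuous p' → Continuous q' →
      IsConv q' → (∀ x z, v (x, z) ≤ p' x + q' z) → ∃ f ∈ S,
        ∫ x, f.1 x ∂(F : Measure (Icc a b)) + ∫ y, f.2 y ∂(G : Measure (Icc c d)) ≤
          ∫ x, p' x ∂(F : Measure (Icc a b)) + ∫ y, q' y ∂(G : Measure (Icc c d)) := by
    intro p' q' hp' hq' hconv hpq
    obtain ⟨p, q, h1, h2, h3, h4, h5, h6, h7⟩ :=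
      exists_dual_improvement hcd hC hM F G hp' hq' hconv hpq
    exact ⟨(BoundedContinuousFunction.mkOfCompact ⟨p, h1.continuous⟩,
      BoundedContinuousFunction.mkOfCompact ⟨q, h2.continuous⟩),
      ⟨⟨⟨h1, h4⟩, ⟨h2, h5⟩⟩, h3, h6⟩, h7⟩
  -- The pair p = M, q = 0 is feasible, so `S` is nonempty.
  obtain ⟨f₀, hf₀, -⟩ := himp (fun _ => M) (fun _ => 0) continuous_const continuous_const
    (by intro y z w s t _ _ _ _; simp) (fun x z => by simpa using (abs_le.1 (hM (x, z))).2)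
  obtain ⟨f, hf, hmin⟩ := hS.exists_isMinOn ⟨f₀, hf₀⟩
    (((continuous_integral_boundedContinuous (F : Measure (Icc a b))).comp continuous_fst).add
      ((continuous_integral_boundedContinuous
        (G : Measure (Icc c d))).comp continuous_snd)).continuousOn
  refine ⟨f.1, f.2, ⟨⟨C, hf.1.1.1⟩, ⟨C, hf.1.2.1⟩, hf.2.2, hf.2.1⟩, ?_⟩
  intro p' q' hp' hq' hconv hpq
  obtain ⟨g, hg, hle⟩ := himp p' q' hp' hq' hconv hpq
  exact (hmin hg).trans hle

/-- Strong duality: the planner attains every lower bound of the dual values. -/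
theorem exists_planner_value (hcd : c < d) {v : Icc a b × Icc c d → ℝ} (hv : Continuous v)
    (F : ProbabilityMeasure (Icc a b)) (G : ProbabilityMeasure (Icc c d)) {m : ℝ}
    (hm : ∀ (p : Icc a b → ℝ) (q : Icc c d → ℝ), Continuous p → Continuous q → IsConv q →
        (∀ x z, v (x, z) ≤ p x + q z) →
        m ≤ ∫ x, p x ∂(F : Measure (Icc a b)) + ∫ y, q y ∂(G : Measure (Icc c d))) :
    ∃ J : ProbabilityMeasure (Icc a b × Icc c d), PlannerFeasible F G J ∧
      m ≤ ∫ w, v w ∂(J : Measure (Icc a b × Icc c d)) := by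
  -- A measure pricing this cone solves the problem: functions ±p fix the first marginal, convex q
  -- give majorization, and t = 1 with p = q = 0 gives E_J[v] ≥ m.
  let D : Set (C(Icc a b × Icc c d, ℝ) × ℝ) := {x | ∃ (p : C(Icc a b, ℝ)) (q : C(Icc c d, ℝ))
    (t : ℝ), 0 ≤ t ∧ IsConv q ∧ (∀ w, x.1 w = p w.1 + q w.2 - t * v w) ∧
      x.2 = ∫ x, p x ∂(F : Measure (Icc a b)) + ∫ y, q y ∂(G : Measure (Icc c d)) - t * m}
  have i1 : ∀ f : C(Icc a b, ℝ), Integrable f (F : Measure (Icc a b)) :=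
    fun f => integrable_of_continuous f.continuous
  have i2 : ∀ f : C(Icc c d, ℝ), Integrable f (G : Measure (Icc c d)) :=
    fun f => integrable_of_continuous f.continuous
  have conv_const : ∀ r : ℝ, IsConv (c := c) (d := d) fun _ => r := fun r => by
    simpa using isConv_affine (c := c) (d := d) r 0
  have conv_smul : ∀ (r : ℝ) (q : Icc c d → ℝ), 0 ≤ r → IsConv q → IsConv fun y => r * q y := by
    intro r q hr hq y z w s t hs ht hst hw
    have := mul_le_mul_of_nonneg_left (hq y z w s t hs ht hst hw) hr
    simp only
    linarith
  obtain ⟨J, hJ⟩ := exists_probabilityMeasure_of_cone D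
    (by
      rintro x ⟨p, q, t, ht, hq, h1, h2⟩ x' ⟨p', q', t', ht', hq', h1', h2'⟩
      refine ⟨p + p', q + q', t + t', add_nonneg ht ht', ?_, fun w => ?_, ?_⟩
      · intro y z w s t hs ht hst hw
        have e1 := hq y z w s t hs ht hst hw
        have e2 := hq' y z w s t hs ht hst hw
        simp only [ContinuousMap.add_apply]
        linarith
      · simp only [Prod.fst_add, ContinuousMap.add_apply, h1, h1']
        ring
      · simp only [Prod.snd_add, ContinuousMap.add_apply, h2, h2']
        rw [integral_add (i1 _) (i1 _), integral_add (i2 _) (i2 _)]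
        ring)
    (by
      rintro r hr x ⟨p, q, t, ht, hq, h1, h2⟩
      refine ⟨r • p, r • q, r * t, mul_nonneg hr ht, conv_smul r q hr hq, fun w => ?_, ?_⟩
      · simp only [Prod.smul_fst, ContinuousMap.smul_apply, smul_eq_mul, h1]
        ring
      · simp only [Prod.smul_snd, ContinuousMap.smul_apply, smul_eq_mul, h2, integral_const_mul]
        ring)
    ⟨1, 0, 0, le_rfl, conv_const 0, fun w => by simp, by simp⟩
    ⟨-1, 0, 0, le_rfl, conv_const 0, fun w => by simp, by simp⟩
    (by
      rintro x ⟨p, q, t, ht, hq, h1, h2⟩ hx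
      have hx' : ∀ y z, t * v (y, z) ≤ p y + q z := by
        intro y z
        have : 0 ≤ x.1 (y, z) := hx (y, z)
        rw [h1] at this
        simp only at this
        linarith
      rw [h2]
      -- If t = 0, then -q z ≤ p y everywhere; averaging over F and then over G gives the claim. If
      -- t > 0, dividing by t yields a feasible dual pair, to which `hm` applies.
      rcases ht.eq_or_lt with rfl | ht
      · have h3 : ∀ z, -q z ≤ ∫ x, p x ∂(F : Measure (Icc a b)) := by
          intro z
          have := integral_mono (μ := (F : Measure (Icc a b))) (integrable_const (-q z)) (i1 p)
            (fun y => show -q z ≤ p y by linarith [hx' y z])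
          simpa using this
        have h4 := integral_mono (i2 q).neg
          (integrable_const (∫ x, p x ∂(F : Measure (Icc a b)))) h3
        rw [integral_neg'] at h4
        simp only [integral_const, probReal_univ, one_smul] at h4
        linarith
      · have h3 := hm (fun y => t⁻¹ * p y) (fun z => t⁻¹ * q z) (by fun_prop) (by fun_prop)
          (conv_smul _ _ (inv_nonneg.2 ht.le) hq) (fun y z => by
            have := mul_le_mul_of_nonneg_left (hx' y z) (inv_nonneg.2 ht.le)
            rwa [inv_mul_cancel_left₀ ht.ne', mul_add] at this)
        rw [integral_const_mul, integral_const_mul, ← mul_add] at h3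
        have := mul_le_mul_of_nonneg_left h3 ht.le
        rw [mul_inv_cancel_left₀ ht.ne'] at this
        linarith)
  have hJ' : ∀ (p : C(Icc a b, ℝ)) (q : C(Icc c d, ℝ)), IsConv q →
      ∫ w, p w.1 + q w.2 ∂(J : Measure (Icc a b × Icc c d)) ≤
        ∫ x, p x ∂(F : Measure (Icc a b)) + ∫ y, q y ∂(G : Measure (Icc c d)) := fun p q hq =>
    hJ (⟨fun w => p w.1 + q w.2, by fun_prop⟩,
      ∫ x, p x ∂(F : Measure (Icc a b)) + ∫ y, q y ∂(G : Measure (Icc c d)))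
      ⟨p, q, 0, le_rfl, hq, fun _ => by simp, by simp⟩
  have hsnd : ∀ q : Icc c d → ℝ, Continuous q →
      ∫ y, q y ∂(J : Measure (Icc a b × Icc c d)).snd =
        ∫ w, q w.2 ∂(J : Measure (Icc a b × Icc c d)) := fun q hq =>
    integral_map measurable_snd.aemeasurable hq.aestronglyMeasurable
  have hconv : ∀ q : Icc c d → ℝ, Continuous q → IsConv q →
      ∫ y, q y ∂(J : Measure (Icc a b × Icc c d)).snd ≤ ∫ y, q y ∂(G : Measure (Icc c d)) := by
    intro q hq hqc
    rw [hsnd q hq]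
    simpa using hJ' 0 ⟨q, hq⟩ hqc
  refine ⟨J, ⟨?_, (majorizes_iff hcd.le).2 ⟨fun t _ => ?_, le_antisymm ?_ ?_⟩⟩, ?_⟩
  · refine ext_of_forall_integral_eq_of_IsFiniteMeasure fun f => ?_
    rw [Measure.fst, integral_map measurable_fst.aemeasurable f.continuous.aestronglyMeasurable]
    have h1 := hJ' f.toContinuousMap 0 (conv_const 0)
    have h2 := hJ' (-f.toContinuousMap) 0 (conv_const 0)
    simp [integral_neg] at h1 h2
    linarith
  · refine hconv _ (by fun_prop) ?_
    intro y z w s r hs hr hsr hw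
    refine max_le ?_ (by positivity)
    have e1 := mul_le_mul_of_nonneg_left (le_max_left (t - (y : ℝ)) 0) hs
    have e2 := mul_le_mul_of_nonneg_left (le_max_left (t - (z : ℝ)) 0) hr
    have : t = s * t + r * t := by rw [← add_mul, hsr, one_mul]
    rw [hw]
    linarith
  · exact hconv _ continuous_subtype_val (by simpa using isConv_affine (c := c) (d := d) 0 1)
  · have := hconv (fun y => -(y : ℝ)) (by fun_prop)
      (by simpa using isConv_affine (c := c) (d := d) 0 (-1))
    rw [integral_neg, integral_neg] at this
    linarith
  · have := hJ (⟨fun w => -v w, by fun_prop⟩, -m)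
      ⟨0, 0, 1, zero_le_one, conv_const 0, fun _ => by simp, by simp⟩
    simp only [ContinuousMap.coe_mk, integral_neg] at this
    linarith

end ManyToOne

/-! ### Equilibrium as equality in weak duality -/

namespace ManyToOne

variable {a b c d : ℝ}

theorem isAssignment_iff (hcd : c < d) {F : ProbabilityMeasure (Icc a b)}
    {G : ProbabilityMeasure (Icc c d)} {J : ProbabilityMeasure (Icc a b × Icc c d)} :
    IsAssignment F G J ↔ PlannerFeasible F G J :=
  ⟨fun h => ⟨h.fst_eq, h.snd_split.majorizes hcd.le⟩,
    fun h => ⟨h.1, Majorizes.obtainedBySplitting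
      (H := ⟨(J : Measure (Icc a b × Icc c d)).snd, inferInstance⟩) hcd h.2⟩⟩

theorem PlannerFeasible.integral_add {F : ProbabilityMeasure (Icc a b)}
    {G : ProbabilityMeasure (Icc c d)} {J : ProbabilityMeasure (Icc a b × Icc c d)}
    (hJ : PlannerFeasible F G J) {p : Icc a b → ℝ} {q : Icc c d → ℝ} (hp : Continuous p)
    (hq : Continuous q) :
    ∫ w, (p w.1 + q w.2) ∂(J : Measure (Icc a b × Icc c d)) =
      ∫ x, p x ∂(F : Measure (Icc a b)) + ∫ z, q z ∂(J : Measure (Icc a b × Icc c d)).snd := by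
  rw [MeasureTheory.integral_add (integrable_of_continuous (by fun_prop))
    (integrable_of_continuous (by fun_prop)), ← hJ.1, Measure.fst, Measure.snd,
    integral_map measurable_fst.aemeasurable hp.aestronglyMeasurable,
    integral_map measurable_snd.aemeasurable hq.aestronglyMeasurable]

theorem IsLip.continuous {α : Type*} [PseudoEMetricSpace α] {f : α → ℝ} (hf : IsLip f) :
    Continuous f :=
  hf.choose_spec.continuous

/-- Weak duality. -/
theorem PlannerFeasible.integral_le {v : Icc a b × Icc c d → ℝ} {F : ProbabilityMeasure (Icc a b)}
    {G : ProbabilityMeasure (Icc c d)} {J : ProbabilityMeasure (Icc a b × Icc c d)}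
    (hcd : c < d) (hv : Continuous v) (hJ : PlannerFeasible F G J) {p : Icc a b → ℝ}
    {q : Icc c d → ℝ} (hpq : DualFeasible v p q) :
    ∫ w, v w ∂(J : Measure (Icc a b × Icc c d)) ≤
      ∫ x, p x ∂(F : Measure (Icc a b)) + ∫ y, q y ∂(G : Measure (Icc c d)) := by
  obtain ⟨hp, hq, hle, hconv⟩ := hpq
  have hp' := hp.continuous
  have hq' := hq.continuous
  calc _ ≤ ∫ w, (p w.1 + q w.2) ∂(J : Measure (Icc a b × Icc c d)) :=
        integral_mono (integrable_of_continuous hv) (integrable_of_continuous (by fun_prop))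
          fun w => hle w.1 w.2
    _ = _ := hJ.integral_add hp' hq'
    _ ≤ _ := add_le_add le_rfl (hJ.2.integral_le hcd hq hconv)

/-- Competitive equilibria are the feasible primal-dual pairs with equal values. -/
theorem isCompetitiveEquilibrium_iff (hcd : c < d) {v : Icc a b × Icc c d → ℝ} (hv : Continuous v)
    {F : ProbabilityMeasure (Icc a b)} {G : ProbabilityMeasure (Icc c d)}
    {J : ProbabilityMeasure (Icc a b × Icc c d)} {p : Icc a b → ℝ} {q : Icc c d → ℝ} :
    IsCompetitiveEquilibrium v F G J p q ↔ PlannerFeasible F G J ∧ DualFeasible v p q ∧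
      ∫ w, v w ∂(J : Measure (Icc a b × Icc c d)) =
        ∫ x, p x ∂(F : Measure (Icc a b)) + ∫ y, q y ∂(G : Measure (Icc c d)) := by
  constructor
  · intro h
    have hJ := (isAssignment_iff hcd).1 h.assignment
    refine ⟨hJ, ⟨h.lip_p, h.lip_q, h.no_entry, h.conv⟩, ?_⟩
    rw [← h.wages, ← hJ.integral_add h.lip_p.continuous h.lip_q.continuous]
    refine integral_congr_ae ?_
    filter_upwards [Measure.support_mem_ae (μ := (J : Measure (Icc a b × Icc c d)))] with w hw
    exact (h.eq_on_support w.1 w.2 hw).symm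
  · rintro ⟨hJ, hpq, heq⟩
    obtain ⟨hp, hq, hle, hconv⟩ := hpq
    have hp' := hp.continuous
    have hq' := hq.continuous
    have i1 : Integrable v (J : Measure (Icc a b × Icc c d)) := integrable_of_continuous hv
    have i2 : Integrable (fun w => p w.1 + q w.2) (J : Measure (Icc a b × Icc c d)) :=
      integrable_of_continuous (by fun_prop)
    -- The two inequalities of weak duality have equal extremes, so each is an equality: one gives v
    -- = p + q almost everywhere, the other the wage condition.
    have h1 : ∫ w, v w ∂(J : Measure (Icc a b × Icc c d)) ≤
        ∫ w, (p w.1 + q w.2) ∂(J : Measure (Icc a b × Icc c d)) :=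
      integral_mono i1 i2 fun w => hle w.1 w.2
    have h2 := hJ.integral_add hp' hq'
    have h3 := hJ.2.integral_le hcd hq hconv
    refine ⟨(isAssignment_iff hcd).2 hJ, hp, hq, fun x z hxz => ?_, hle, hconv, by linarith⟩
    have hae : v =ᵐ[(J : Measure (Icc a b × Icc c d))] fun w => p w.1 + q w.2 :=
      (integral_eq_iff_of_ae_le i1 i2 (Filter.Eventually.of_forall fun w => hle w.1 w.2)).1
        (by linarith)
    -- By continuity the equality set is closed; having full measure, it contains the support.
    have hcl : IsClosed {w : Icc a b × Icc c d | v w = p w.1 + q w.2} :=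
      isClosed_eq hv (by fun_prop)
    exact (Measure.support_subset_of_isClosed hcl hae hxz).symm

end ManyToOne

theorem theorem2 {a b c d : ℝ} (hab : a < b) (hcd : c < d)
    (v : Icc a b × Icc c d → ℝ) (hv : ManyToOne.IsLip v)
    (F : ProbabilityMeasure (Icc a b)) (G : ProbabilityMeasure (Icc c d)) :
    (∃ (J : ProbabilityMeasure (Icc a b × Icc c d)) (p : Icc a b → ℝ) (q : Icc c d → ℝ),
      ManyToOne.IsCompetitiveEquilibrium v F G J p q) ∧
    (∀ (J : ProbabilityMeasure (Icc a b × Icc c d)) (p : Icc a b → ℝ) (q : Icc c d → ℝ),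
      ManyToOne.IsCompetitiveEquilibrium v F G J p q ↔
        ManyToOne.SolvesPlanner v F G J ∧ ManyToOne.SolvesDual v F G p q) ∧
    (∀ J : ProbabilityMeasure (Icc a b × Icc c d),
      ManyToOne.IsAssignment F G J ↔
        (J : Measure (Icc a b × Icc c d)).fst = (F : Measure (Icc a b)) ∧
        ManyToOne.Majorizes (J : Measure (Icc a b × Icc c d)).snd (G : Measure (Icc c d))) := by
  have hvc := hv.continuous
  obtain ⟨p₀, q₀, hpq₀, hopt⟩ := ManyToOne.exists_dual_solution hcd.le hv F G
  -- The cone argument tests against all continuous dual pairs, which is why `hopt` covers these and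
  -- not only Lipschitz ones.
  obtain ⟨J₀, hJ₀, hval⟩ := ManyToOne.exists_planner_value hcd hvc F G hopt
  have hdual := hJ₀.integral_le hcd hvc hpq₀
  refine ⟨⟨J₀, p₀, q₀, (ManyToOne.isCompetitiveEquilibrium_iff hcd hvc).2
    ⟨hJ₀, hpq₀, le_antisymm hdual hval⟩⟩, fun J p q => ?_,
    fun J => ManyToOne.isAssignment_iff hcd⟩
  rw [ManyToOne.isCompetitiveEquilibrium_iff hcd hvc]
  constructor
  · rintro ⟨hJ, hpq, heq⟩
    exact ⟨⟨hJ, fun J' hJ' => heq ▸ hJ'.integral_le hcd hvc hpq⟩,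
      ⟨hpq, fun p' q' hpq' => heq ▸ hJ.integral_le hcd hvc hpq'⟩⟩
  -- Comparison with the reference solutions closes the gap: the value of (p, q) is at most that of
  -- (p₀, q₀), which is at most E_{J₀}[v] ≤ E_J[v].
  · rintro ⟨⟨hJ, hJmax⟩, ⟨hpq, hpqmin⟩⟩
    exact ⟨hJ, hpq, le_antisymm (hJ.integral_le hcd hvc hpq)
      ((hpqmin p₀ q₀ hpq₀).trans (hval.trans (hJmax J₀ hJ₀)))⟩
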